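/- Let $M$ be a simple matroid of rank $r$ on a finite linearly ordered set $E$ (simple: every circuit has at least three elements), with closure operator $\mathrm{cl}$, rank function $r(\cdot)$ and lattice of flats $L(M)$ ordered by inclusion; let $\mu$ be the M\"obius function of $L(M)$ and $$\chi(M;\lambda)=\sum_{X\in L(M)}\mu(\emptyset,X)\,\lambda^{\,r-r(X)}$$ the characteristic polynomial of $M$. Let $\mathbf k$ be a field of characteristic different from $2$, let $\Lambda(E)$ be the exterior algebra of $\mathbf k^E$ with standard basis $(e_i)_{i\in E}$, put $e_T=e_{i_1}\wedge\cdots\wedge e_{i_k}$ for a sequence $T=(i_1,\dots,i_k)$ in $E$, and let $\partial:\Lambda(E)\to\Lambda(E)$ be the linear map with $\partial 1=0$ and $\partial e_T=\sum_{j=1}^k(-1)^{j-1}e_{T-i_j}$, where $T-i_j$ is $T$ with its $j$th term deleted. Let $I(M)$ be the ideal of $\Lambda(E)$ generated by the elements $\partial e_C$, $C$ a circuit of $M$ (written in increasing order), and let $\mathsf A(M)=\Lambda(E)/I(M)$ be the Orlik--Solomon algebra. For a flat $Y$ let $\mathsf A^Y(M)$ be the image in $\mathsf A(M)$ of the span of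 the $e_T$ with $\mathrm{cl}(T)=Y$, and for $k\ge 0$ let $\mathsf A^k(M)$ be the image of $\Lambda^k(E)$. Then for every flat $Y$ of $M$ $$\dim_{\mathbf k}\mathsf A^Y(M)=(-1)^{r(Y)}\mu(\emptyset,Y),$$ and the Hilbert series $H(\mathsf A(M);t)=\sum_{k\ge 0}\dim_{\mathbf k}(\mathsf A^k(M))\,t^k$ satisfies $$H(\mathsf A(M);t)=\sum_{X\in L(M)}(-1)^{r(X)}\mu(\emptyset,X)\,t^{r(X)}=(-t)^r\,\chi(M;-1/t).$$ -/

import Mathlib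

open scoped ExteriorAlgebra LaurentSeries

noncomputable section

namespace OrlikSolomon

/-! ### Matroids and their lattices of flats -/

/-- A matroid is simple if it has no loops and no parallel elements, that is, if it has no circuit
with one or two elements. -/
def IsSimple {E : Type*} (M : Matroid E) : Prop :=
  ∀ C, M.IsCircuit C → 3 ≤ C.encard

/-- The set `L(M)` of flats of `M`, ordered by inclusion. -/
abbrev Flats {E : Type*} (M : Matroid E) : Type _ := {X : Set E // M.IsFlat X}

instance {E : Type*} [Finite E] (M : Matroid E) : Fintype (Flats M) := Fintype.ofFinite _

open Classical in
instance {E : Type*} [Finite E] (M : Matroid E) : LocallyFiniteOrder (Flats M) :=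
  Fintype.toLocallyFiniteOrder

/-- The least flat is the closure of the empty set. -/
instance {E : Type*} (M : Matroid E) : OrderBot (Flats M) where
  bot := ⟨M.closure ∅, M.isFlat_closure ∅⟩
  bot_le X := by
    have h := M.closure_subset_closure (Set.empty_subset (X : Set E))
    rw [X.2.closure] at h
    exact h

/-- In a simple matroid the least flat is the empty set. -/
theorem coe_bot_eq_empty {E : Type*} {M : Matroid E} (hM : IsSimple M) :
    ((⊥ : Flats M) : Set E) = ∅ := by
  refine Set.eq_empty_iff_forall_notMem.2 fun e he => ?_
  have he' : M.IsLoop e := he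
  have h := hM {e} (Matroid.singleton_isCircuit.2 he')
  simp at h

/-- The rank `r(X)` of a set, as a natural number (ranks are finite for finite `E`). -/
def rk {E : Type*} (M : Matroid E) (X : Set E) : ℕ := (M.eRk X).toNat

open Classical in
/-- The value `μ(⊥, X)` of the Möbius function of the lattice of flats; for a simple matroid,
`⊥` is the empty flat, so this is `μ(∅, X)`. -/
def mu {E : Type*} [Finite E] (M : Matroid E) (X : Flats M) : ℤ :=
  IncidenceAlgebra.mu ℤ (⊥ : Flats M) X

/-- The characteristic polynomial `χ(M; λ) = ∑_X μ(∅, X) λ^(r - r(X))`, where `r` is the rank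
of `M`. -/
def charPoly {E : Type*} [Finite E] (M : Matroid E) : Polynomial ℤ :=
  ∑ X : Flats M, Polynomial.C (mu M X) * Polynomial.X ^ (rk M M.E - rk M X)

/-! ### The exterior algebra -/

section Exterior

variable (K : Type*) [Field K] {E : Type*}

/-- The exterior algebra `Λ(E)` of the vector space `K^E`. -/
abbrev Ext (E : Type*) : Type _ := ExteriorAlgebra K (E → K)

/-- The exterior product `e_T = e_{i₁} ∧ ⋯ ∧ e_{iₖ}` of the standard basis vectors indexed by the
terms of a sequence `T = (i₁, …, iₖ)`. -/
def e [DecidableEq E] (T : List E) : Ext K E :=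
  (T.map fun i => ExteriorAlgebra.ι K (Pi.single i (1 : K))).prod

/-- The boundary operator `∂ : Λ(E) → Λ(E)`, the contraction with the linear functional that is `1`
on every standard basis vector. Its values on the exterior products `e_T` are computed in
`boundary_e`. -/
def boundary (E : Type*) [Fintype E] : Ext K E →ₗ[K] Ext K E :=
  CliffordAlgebra.contractLeft (Q := (0 : QuadraticForm K (E → K)))
    (∑ i : E, LinearMap.proj i : (E → K) →ₗ[K] K)

/-- The boundary operator is given by `∂ 1 = 0` and `∂ e_T = ∑ⱼ (-1)^(j-1) e_{T - iⱼ}`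
(here `j` is counted from `0`). -/
theorem boundary_e [Fintype E] [DecidableEq E] (T : List E) :
    boundary K E (e K T) = ∑ j : Fin T.length, (-1 : Ext K E) ^ (j : ℕ) * e K (T.eraseIdx j) := by
  induction T with
  | nil => simp [e, boundary]
  | cons a T ih =>
    have h1 : e K (a :: T) =
        CliffordAlgebra.ι (0 : QuadraticForm K (E → K)) (Pi.single a (1 : K)) * e K T := by
      simp [e, ExteriorAlgebra.ι]
    have h2 : ∀ j : Fin T.length, e K ((a :: T).eraseIdx (j.succ : Fin (T.length + 1))) =
        CliffordAlgebra.ι (0 : QuadraticForm K (E → K)) (Pi.single a (1 : K)) *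
          e K (T.eraseIdx j) := by
      intro j
      simp [e, ExteriorAlgebra.ι]
    have h3 : (∑ i : E, LinearMap.proj i : (E → K) →ₗ[K] K) (Pi.single a 1) = 1 := by
      simp [LinearMap.sum_apply]
    have h4 : boundary K E (e K (a :: T)) = e K T -
        CliffordAlgebra.ι (0 : QuadraticForm K (E → K)) (Pi.single a (1 : K)) *
          boundary K E (e K T) := by
      rw [h1, boundary, CliffordAlgebra.contractLeft_ι_mul, h3, one_smul]
    rw [h4, ih, List.length_cons, Fin.sum_univ_succ, sub_eq_add_neg, Finset.mul_sum,
      ← Finset.sum_neg_distrib]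
    congr 1
    · simp
    · refine Finset.sum_congr rfl fun j _ => ?_
      rw [h2, Fin.val_succ, pow_succ, mul_neg_one, neg_mul, ← mul_assoc, ← mul_assoc,
        ((Commute.neg_one_left _).pow_left _).eq]

variable [Fintype E] [LinearOrder E]

/-- The ideal `I(M)` of `Λ(E)` generated by the elements `∂ e_C`, `C` a circuit of `M`
(written as an increasing sequence). -/
def osIdeal (M : Matroid E) : Ideal (Ext K E) :=
  (TwoSidedIdeal.span
    {x | ∃ C : Finset E, M.IsCircuit (C : Set E) ∧ x = boundary K E (e K (C.sort (· ≤ ·)))}).asIdeal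

instance (M : Matroid E) : (osIdeal K M).IsTwoSided := by
  unfold osIdeal; infer_instance

/-- The Orlik-Solomon algebra `A(M) = Λ(E) / I(M)`. -/
abbrev OSAlgebra (M : Matroid E) : Type _ := Ext K E ⧸ osIdeal K M

/-- The subspace `Λ^X(E)` spanned by the exterior products `e_T` with `cl(T) = X`. -/
def extFlat (M : Matroid E) (X : Set E) : Submodule K (Ext K E) :=
  Submodule.span K {x | ∃ T : List E, M.closure {i | i ∈ T} = X ∧ x = e K T}

/-- The component `A^X(M)` of the grading by flats: the image of `Λ^X(E)`, that is,
`Λ^X(E) / (I(M) ∩ Λ^X(E))`. -/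
def osFlat (M : Matroid E) (X : Set E) : Submodule K (OSAlgebra K M) :=
  (extFlat K M X).map (Ideal.Quotient.mkₐ K (osIdeal K M)).toLinearMap

/-- The component `A^k(M)` of grade `k`: the image of `Λ^k(E)`, that is,
`Λ^k(E) / (I(M) ∩ Λ^k(E))`. -/
def osGrade (M : Matroid E) (k : ℕ) : Submodule K (OSAlgebra K M) :=
  (⋀[K]^k (E → K)).map (Ideal.Quotient.mkₐ K (osIdeal K M)).toLinearMap

end Exterior

/-- The Hilbert series `∑ₖ dim(Rᵏ) tᵏ` of an algebra with graded pieces `Rᵏ`. -/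
def hilbertSeries (K : Type*) [Field K] {R : Type*} [Ring R] [Algebra K R]
    (𝒜 : ℕ → Submodule K R) : PowerSeries ℚ :=
  PowerSeries.mk fun k => (Module.finrank K (𝒜 k) : ℚ)

end OrlikSolomon

end

noncomputable section

namespace OrlikSolomon

/-! ### Monomials in the exterior algebra -/

section Monomials

variable (K : Type*) [Field K] {E : Type*} [DecidableEq E]

/-! The signed dimensions `(-1)^r(X) dim A^X` satisfy the recursion that defines `μ(∅, X)`: the
value at `∅` is `1`, and the sum over the flats below any nonempty flat `Y` is `0`.

The components `A^X` are independent. Killing the `e_i` with `i ∉ Y` preserves the ideal, because a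
circuit with all but one element in the flat `Y` lies in `Y` (`restrictTo_mem_osIdeal`). The induced
map on `A(M)` is the identity on `A^X` for `X ≤ Y` and zero on the other components, so a
triangularity argument applies.

For the vanishing sum, choose `i ∈ Y`. Since `∂` preserves the ideal (`boundary_mem_osIdeal`), `φ =
e_i ∧ · + ∂` acts on `A(M)`. It is an involution, and it exchanges the even-rank and odd-rank parts
of the sum of the `A^X` with `X ≤ Y`. These parts therefore have equal dimension.

Monomials of dependent sequences vanish in `A(M)`, so `A^k` is the sum of the `A^X` with `r(X) = k`;
this gives the Hilbert series. -/

theorem e_nil : e K ([] : List E) = 1 := rfl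

theorem e_cons (a : E) (T : List E) :
    e K (a :: T) = ExteriorAlgebra.ι K (Pi.single a (1 : K)) * e K T := by
  simp [e]

theorem e_append (S T : List E) : e K (S ++ T) = e K S * e K T := by
  simp [e]

theorem e_eq_ιMulti (T : List E) :
    e K T = ExteriorAlgebra.ιMulti K T.length fun i => Pi.single (T.get i) (1 : K) := by
  rw [ExteriorAlgebra.ιMulti_apply, e]
  congr 1
  apply List.ext_get <;> simp

theorem e_eq_zero_of_not_nodup {T : List E} (hT : ¬ T.Nodup) : e K T = 0 := by
  rw [e_eq_ιMulti]
  refine ExteriorAlgebra.ιMulti_eq_zero_of_not_inj fun h => hT ?_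
  rw [List.nodup_iff_injective_get]
  intro i j hij
  exact h (by simp only [hij])

/-- Reordering a sequence changes its monomial at most by a sign. -/
theorem e_perm {S T : List E} (h : S.Perm T) : e K S = e K T ∨ e K S = -e K T := by
  induction h with
  | nil => exact Or.inl rfl
  | cons a _ ih =>
    rcases ih with ih | ih
    · exact Or.inl (by rw [e_cons, e_cons, ih])
    · exact Or.inr (by rw [e_cons, e_cons, ih, mul_neg])
  | swap a b T =>
    right
    simp only [e_cons, ← mul_assoc]
    rw [← neg_mul, eq_neg_of_add_eq_zero_left (ExteriorAlgebra.ι_add_mul_swap _ _)]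
  | trans _ _ ih₁ ih₂ =>
    rcases ih₁ with h₁ | h₁ <;> rcases ih₂ with h₂ | h₂ <;> simp [h₁, h₂]

theorem involute_e (T : List E) :
    CliffordAlgebra.involute (Q := (0 : QuadraticForm K (E → K))) (e K T) =
      (-1 : Ext K E) ^ T.length * e K T := by
  induction T with
  | nil => simp [e_nil]
  | cons a T ih =>
    rw [e_cons, map_mul, ih]
    have h : CliffordAlgebra.involute (Q := (0 : QuadraticForm K (E → K)))
        (ExteriorAlgebra.ι K (Pi.single a (1 : K))) =
          -ExteriorAlgebra.ι K (Pi.single a (1 : K)) := CliffordAlgebra.involute_ι _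
    rw [h, List.length_cons, pow_succ, mul_neg_one, neg_mul, neg_mul, neg_inj, ← mul_assoc,
      ← mul_assoc, ((Commute.neg_one_left _).pow_left _).eq]

/-- The monomials span every exterior power. -/
theorem span_e_eq_exteriorPower [Finite E] (k : ℕ) :
    Submodule.span K {x : Ext K E | ∃ T : List E, T.length = k ∧ x = e K T} =
      ⋀[K]^k (E → K) := by
  have hs : Submodule.span K (Set.range fun i : E => (Pi.single i (1 : K) : E → K)) = ⊤ := by
    have := (Pi.basisFun K E).span_eq
    convert this using 3
    ext i
    simp
  rw [← exteriorPower.ιMulti_span_fixedDegree_of_span_eq_top K k _ hs]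
  congr 1
  ext x
  constructor
  · rintro ⟨T, rfl, rfl⟩
    refine ⟨_, ?_, (e_eq_ιMulti K T).symm⟩
    rintro _ ⟨i, rfl⟩
    exact ⟨_, rfl⟩
  · rintro ⟨a, ha, rfl⟩
    choose f hf using fun i => ha ⟨i, rfl⟩
    refine ⟨List.ofFn f, by simp, ?_⟩
    rw [ExteriorAlgebra.ιMulti_apply, e, List.map_ofFn]
    congr 2
    ext i
    simp [← hf]

end Monomials

/-! ### The boundary operator is an antiderivation -/

section Boundary

variable (K : Type*) [Field K] {E : Type*} [Fintype E]

theorem boundary_ι_mul [DecidableEq E] (i : E) (x : Ext K E) :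
    boundary K E (ExteriorAlgebra.ι K (Pi.single i (1 : K)) * x) =
      x - ExteriorAlgebra.ι K (Pi.single i (1 : K)) * boundary K E x := by
  have h : (∑ i : E, LinearMap.proj i : (E → K) →ₗ[K] K) (Pi.single i 1) = 1 := by
    simp [LinearMap.sum_apply]
  have := CliffordAlgebra.contractLeft_ι_mul (Q := (0 : QuadraticForm K (E → K)))
    (d := (∑ i : E, LinearMap.proj i : (E → K) →ₗ[K] K)) (Pi.single i 1) x
  rw [h, one_smul] at this
  exact this

theorem boundary_boundary (x : Ext K E) : boundary K E (boundary K E x) = 0 :=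
  CliffordAlgebra.contractLeft_contractLeft _ x

theorem boundary_mul (x y : Ext K E) :
    boundary K E (x * y) = boundary K E x * y +
      CliffordAlgebra.involute (Q := (0 : QuadraticForm K (E → K))) x * boundary K E y := by
  refine CliffordAlgebra.left_induction (Q := (0 : QuadraticForm K (E → K)))
    (P := fun x => boundary K E (x * y) = boundary K E x * y +
      CliffordAlgebra.involute (Q := (0 : QuadraticForm K (E → K))) x * boundary K E y)
    ?_ ?_ ?_ x
  · intro r
    rw [boundary, CliffordAlgebra.contractLeft_algebraMap_mul,
      CliffordAlgebra.contractLeft_algebraMap]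
    simp
  · intro a b ha hb
    rw [add_mul, map_add, ha, hb, map_add, map_add]
    noncomm_ring
  · intro a v ha
    rw [mul_assoc]
    simp only [boundary, CliffordAlgebra.contractLeft_ι_mul] at ha ⊢
    rw [ha, map_mul, CliffordAlgebra.involute_ι, sub_mul, smul_mul_assoc]
    noncomm_ring

end Boundary

/-! ### The Orlik-Solomon ideal -/

section Ideal

variable {K : Type*} [Field K] {E : Type*} [Fintype E] [LinearOrder E] {M : Matroid E}

theorem boundary_e_mem_osIdeal {C : Finset E} (hC : M.IsCircuit (C : Set E)) :
    boundary K E (e K (C.sort (· ≤ ·))) ∈ osIdeal K M :=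
  TwoSidedIdeal.subset_span ⟨C, hC, rfl⟩

/-- An induction principle for the Orlik-Solomon ideal. -/
theorem osIdeal_induction {p : Ext K E → Prop}
    (mem : ∀ C : Finset E, M.IsCircuit (C : Set E) → ∀ a b : Ext K E,
      p (a * boundary K E (e K (C.sort (· ≤ ·))) * b))
    (zero : p 0) (add : ∀ x y, p x → p y → p (x + y))
    {x : Ext K E} (hx : x ∈ osIdeal K M) : p x := by
  have hx' := TwoSidedIdeal.mem_span_iff_mem_addSubgroup_closure.1
    (TwoSidedIdeal.mem_asIdeal.1 hx)
  clear hx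
  -- `p` is not assumed stable under negation, so both signs are carried along; on generators the
  -- sign is absorbed into the left factor.
  suffices h : p x ∧ p (-x) from h.1
  induction hx' using AddSubgroup.closure_induction with
  | mem x hx =>
    obtain ⟨_, ⟨a, -, _, ⟨C, hC, rfl⟩, rfl⟩, b, -, rfl⟩ := hx
    exact ⟨mem C hC a b, by simpa using mem C hC (-a) b⟩
  | zero => simpa using zero
  | add x y _ _ hx hy => exact ⟨add _ _ hx.1 hy.1, by rw [neg_add]; exact add _ _ hx.2 hy.2⟩
  | neg x _ hx => exact ⟨hx.2, by simpa using hx.1⟩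

/-- The monomial of a circuit lies in the ideal. -/
theorem e_sort_mem_osIdeal {C : Finset E} (hC : M.IsCircuit (C : Set E)) :
    e K (C.sort (· ≤ ·)) ∈ osIdeal K M := by
  have h := boundary_e_mem_osIdeal (K := K) hC
  rcases hL : C.sort (· ≤ ·) with _ | ⟨c, L⟩
  · have h0 : C = ∅ := by simpa using congrArg List.toFinset hL
    have := hC.nonempty
    simp [h0] at this
  · rw [hL, e_cons, boundary_ι_mul] at h
    -- Multiplying `∂ e_C = e_L - e_c ∂ e_L` by `e_c` kills the second term, since `e_c² = 0`, and
    -- leaves `e_C`.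
    have h' := (osIdeal K M).mul_mem_left (ExteriorAlgebra.ι K (Pi.single c (1 : K))) h
    rwa [mul_sub, ← mul_assoc, ExteriorAlgebra.ι_sq_zero, zero_mul, sub_zero, ← e_cons] at h'

/-- The monomials of dependent sequences lie in the ideal. -/
theorem e_mem_osIdeal_of_not_indep (hE : M.E = Set.univ) {T : List E}
    (hT : ¬ (T.Nodup ∧ M.Indep {i | i ∈ T})) : e K T ∈ osIdeal K M := by
  by_cases hn : T.Nodup
  · have hd : M.Dep {i | i ∈ T} :=
      (M.not_indep_iff (by simp [hE])).1 fun h => hT ⟨hn, h⟩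
    obtain ⟨C, hCT, hC⟩ := hd.exists_isCircuit_subset
    obtain ⟨C, rfl⟩ : ∃ D : Finset E, (D : Set E) = C := ⟨C.toFinite.toFinset, by simp⟩
    have hp : T.Perm (C.sort (· ≤ ·) ++ T.filter (· ∉ C)) := by
      have h1 : (T.filter (· ∈ C)).Perm (C.sort (· ≤ ·)) := by
        rw [List.perm_ext_iff_of_nodup (hn.filter _) (Finset.sort_nodup _ _)]
        intro a
        simp only [List.mem_filter, decide_eq_true_eq, Finset.mem_sort, and_iff_right_iff_imp]
        exact fun h => hCT h
      have h2 := List.filter_append_perm (· ∈ C) T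
      refine h2.symm.trans ?_
      simpa using h1.append_right _
    have hm : e K (C.sort (· ≤ ·) ++ T.filter (· ∉ C)) ∈ osIdeal K M := by
      rw [e_append]
      exact Ideal.mul_mem_right _ _ (e_sort_mem_osIdeal hC)
    rcases e_perm K hp with h | h <;> rw [h]
    · exact hm
    · exact (osIdeal K M).neg_mem hm
  · rw [e_eq_zero_of_not_nodup K hn]
    exact zero_mem _

/-- `∂ e_T` is homogeneous of degree `|T| - 1`; the exponent `|T| + 1` has the same parity and
avoids truncated subtraction. -/
theorem involute_boundary_e (T : List E) :
    CliffordAlgebra.involute (Q := (0 : QuadraticForm K (E → K))) (boundary K E (e K T)) =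
      (-1 : Ext K E) ^ (T.length + 1) * boundary K E (e K T) := by
  rw [boundary_e, map_sum, Finset.mul_sum]
  refine Finset.sum_congr rfl fun j _ => ?_
  rw [map_mul, involute_e, map_pow, map_neg, map_one, List.length_eraseIdx_of_lt j.2]
  have h : (-1 : Ext K E) ^ (T.length + 1) = (-1) ^ (T.length - 1) := by
    have := j.2
    obtain ⟨n, hn⟩ : ∃ n, T.length = n + 1 := ⟨T.length - 1, by omega⟩
    rw [hn]; simp [pow_succ]
  rw [h, ← mul_assoc, ← mul_assoc, ← pow_add, ← pow_add, add_comm]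

/-- Apply the signed Leibniz rule to `a g b` with `g = ∂ e_C`: the term with `∂ g` vanishes, and the
grade involution changes `g` only by a sign, so each remaining term still has the factor `g`. -/
theorem boundary_mem_osIdeal {x : Ext K E} (hx : x ∈ osIdeal K M) :
    boundary K E x ∈ osIdeal K M := by
  refine osIdeal_induction (p := fun x => boundary K E x ∈ osIdeal K M) ?_ ?_ ?_ hx
  · intro C hC a b
    have hg := boundary_e_mem_osIdeal (K := K) hC
    rw [boundary_mul, boundary_mul, boundary_boundary, map_mul, involute_boundary_e, mul_zero,
      add_zero]
    refine add_mem ?_ ?_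
    · exact Ideal.mul_mem_right _ _ (Ideal.mul_mem_left _ _ hg)
    · exact Ideal.mul_mem_right _ _ (Ideal.mul_mem_left _ _ (Ideal.mul_mem_left _ _ hg))
  · simp
  · intro x y hx hy
    rw [map_add]
    exact add_mem hx hy

end Ideal

/-! ### Restriction to a set of coordinates -/

section Restriction

variable (K : Type*) [Field K] {E : Type*} [LinearOrder E]

open Classical in
/-- The algebra endomorphism of `Λ(E)` that fixes the basis vectors indexed by `Y` and kills the
others. -/
def restrictTo (Y : Set E) : Ext K E →ₐ[K] Ext K E :=
  ExteriorAlgebra.map (LinearMap.pi fun i => if i ∈ Y then LinearMap.proj i else 0)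

theorem restrictTo_ι_of_mem {Y : Set E} {i : E} (hi : i ∈ Y) :
    restrictTo K Y (ExteriorAlgebra.ι K (Pi.single i (1 : K))) =
      ExteriorAlgebra.ι K (Pi.single i (1 : K)) := by
  rw [restrictTo, ExteriorAlgebra.map_apply_ι]
  congr 1
  ext j
  by_cases hj : j ∈ Y
  · simp [hj]
  · simp [hj, show j ≠ i by rintro rfl; exact hj hi]

theorem restrictTo_ι_of_notMem {Y : Set E} {i : E} (hi : i ∉ Y) :
    restrictTo K Y (ExteriorAlgebra.ι K (Pi.single i (1 : K))) = 0 := by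
  rw [restrictTo, ExteriorAlgebra.map_apply_ι]
  convert map_zero (ExteriorAlgebra.ι K (M := E → K))
  ext j
  by_cases hj : j ∈ Y
  · simp [hj, show j ≠ i by rintro rfl; exact hi hj]
  · simp [hj]

theorem restrictTo_e_of_subset {Y : Set E} {T : List E} (hT : ∀ i ∈ T, i ∈ Y) :
    restrictTo K Y (e K T) = e K T := by
  induction T with
  | nil => simp [e_nil]
  | cons a T ih =>
    rw [e_cons, map_mul, ih fun i hi => hT i (List.mem_cons_of_mem _ hi),
      restrictTo_ι_of_mem K (hT a List.mem_cons_self)]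

theorem restrictTo_e_of_notMem {Y : Set E} {T : List E} {i : E} (hi : i ∈ T) (hY : i ∉ Y) :
    restrictTo K Y (e K T) = 0 := by
  rw [e, map_list_prod]
  refine List.prod_eq_zero ?_
  rw [List.mem_map]
  exact ⟨_, List.mem_map.2 ⟨i, hi, rfl⟩, restrictTo_ι_of_notMem K hY⟩

variable {K} [Fintype E] {M : Matroid E}

theorem restrictTo_mem_osIdeal {Y : Set E} (hY : M.IsFlat Y) {x : Ext K E}
    (hx : x ∈ osIdeal K M) : restrictTo K Y x ∈ osIdeal K M := by
  refine osIdeal_induction (p := fun x => restrictTo K Y x ∈ osIdeal K M) ?_ ?_ ?_ hx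
  · intro C hC a b
    rw [map_mul, map_mul]
    refine Ideal.mul_mem_right _ _ (Ideal.mul_mem_left _ _ ?_)
    by_cases hCY : (C : Set E) ⊆ Y
    · suffices h : restrictTo K Y (boundary K E (e K (C.sort (· ≤ ·)))) =
          boundary K E (e K (C.sort (· ≤ ·))) by
        rw [h]
        exact boundary_e_mem_osIdeal hC
      rw [boundary_e, map_sum]
      refine Finset.sum_congr rfl fun j _ => ?_
      rw [map_mul, map_pow, map_neg, map_one, restrictTo_e_of_subset]
      intro i hi
      exact hCY (by simpa using List.mem_of_mem_eraseIdx hi)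
    · suffices h : restrictTo K Y (boundary K E (e K (C.sort (· ≤ ·)))) = 0 by
        rw [h]
        exact zero_mem _
      rw [boundary_e, map_sum]
      refine Finset.sum_eq_zero fun j _ => ?_
      -- Otherwise `C` minus one element lies in `Y`; its closure contains `C`, and `Y` is closed,
      -- so `C ⊆ Y`.
      obtain ⟨i, hi, hiY⟩ : ∃ i ∈ (C.sort (· ≤ ·)).eraseIdx j, i ∉ Y := by
        by_contra! h
        apply hCY
        have hsub : (C : Set E) \ {(C.sort (· ≤ ·))[j]} ⊆ Y := by
          rintro i ⟨hi, hij⟩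
          refine h i (List.mem_eraseIdx_iff_getElem.2 ?_)
          obtain ⟨k, hk, rfl⟩ := List.getElem_of_mem ((Finset.mem_sort (· ≤ ·)).2 hi)
          exact ⟨k, hk, fun hkj => hij (by simp [hkj]), rfl⟩
        have hcl := M.closure_subset_closure hsub
        rw [hY.closure] at hcl
        exact (hC.subset_closure_sdiff_singleton _).trans hcl
      rw [map_mul, restrictTo_e_of_notMem K hi hiY, mul_zero]
  · simp
  · intro x y hx hy
    rw [map_add]
    exact add_mem hx hy

end Restriction

/-! ### Dimensions of independent sums -/

theorem finrank_sup_eq_sum {K V ι : Type*} [Field K] [AddCommGroup V] [Module K V]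
    {W : ι → Submodule K V} [∀ i, FiniteDimensional K (W i)] (hW : iSupIndep W) (s : Finset ι) :
    Module.finrank K (s.sup W : Submodule K V) = ∑ i ∈ s, Module.finrank K (W i) := by
  classical
  induction s using Finset.induction_on with
  | empty => simp
  | insert a s ha ih =>
    have hd : Disjoint (W a) (s.sup W) := by
      have := iSupIndep_iff_supIndep.1 hW (insert a s)
      exact this (Finset.subset_insert a s) (Finset.mem_insert_self a s) ha
    have h := Submodule.finrank_sup_add_finrank_inf_eq (W a) (s.sup W)
    rw [hd.eq_bot, finrank_bot, add_zero] at h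
    rw [Finset.sup_insert, Finset.sum_insert ha, h, ih]

/-- A family of submodules of which each partial sum over a principal lower set is cut out by an
operator is independent. -/
theorem iSupIndep_of_projections {K V ι : Type*} [Field K] [AddCommGroup V] [Module K V]
    [PartialOrder ι] [Finite ι] {W : ι → Submodule K V} (p : ι → V →ₗ[K] V)
    (hp : ∀ Y X, X ≤ Y → ∀ a ∈ W X, p Y a = a) (hp' : ∀ Y X, ¬ X ≤ Y → ∀ a ∈ W X, p Y a = 0) :
    iSupIndep W := by
  classical
  rw [iSupIndep_iff_finsetSum_eq_zero_imp_eq_zero]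
  intro s v hv h0
  -- Apply `p Y` to the relation: terms not below `Y` are killed, terms strictly below vanish by
  -- induction, and `v Y` is fixed.
  have key : ∀ Y : ι, Y ∈ s → v Y = 0 := by
    intro Y
    induction Y using WellFoundedLT.induction with
    | _ Y ih =>
      intro hY
      have h := congrArg (p Y) h0
      rw [map_sum, map_zero, Finset.sum_eq_single_of_mem Y hY] at h
      · rwa [hp Y Y le_rfl _ (hv Y hY)] at h
      · intro X hX hXY
        by_cases hle : X ≤ Y
        · rw [ih X (lt_of_le_of_ne hle hXY) hX, map_zero]
        · exact hp' Y X hle _ (hv X hX)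
  exact key

/-! ### Ranks -/

theorem rk_closure_of_indep {E : Type*} {M : Matroid E} {T : List E} (hn : T.Nodup) (hi : M.Indep {i | i ∈ T}) :
    rk M (M.closure {i | i ∈ T}) = T.length := by
  classical
  rw [rk, M.eRk_closure_eq, hi.eRk_eq_encard]
  have : {i | i ∈ T} = (T.toFinset : Set E) := by ext; simp
  rw [this, Set.encard_coe_eq_coe_finsetCard, List.toFinset_card_of_nodup hn]
  rfl

theorem rk_bot {E : Type*} {M : Matroid E} : rk M (⊥ : Flats M) = 0 := by
  change rk M (M.closure ∅) = 0
  simp [rk]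

/-! ### The flat components of the Orlik-Solomon algebra -/

section Components

variable {K : Type*} [Field K] {E : Type*} [Fintype E] [LinearOrder E] {M : Matroid E}

/-- A linear endomorphism of `Λ(E)` that preserves the Orlik-Solomon ideal descends. -/
theorem exists_descend (f : Ext K E →ₗ[K] Ext K E)
    (hf : ∀ x ∈ osIdeal K M, f x ∈ osIdeal K M) :
    ∃ g : OSAlgebra K M →ₗ[K] OSAlgebra K M, ∀ x,
      g (Ideal.Quotient.mkₐ K (osIdeal K M) x) = Ideal.Quotient.mkₐ K (osIdeal K M) (f x) := by
  set q := (Ideal.Quotient.mkₐ K (osIdeal K M)).toLinearMap with hq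
  have hs : LinearMap.range q = ⊤ :=
    LinearMap.range_eq_top.2 (Ideal.Quotient.mkₐ_surjective K (osIdeal K M))
  obtain ⟨s, hs⟩ := q.exists_rightInverse_of_surjective hs
  refine ⟨q ∘ₗ f ∘ₗ s, fun x => ?_⟩
  have h : s (q x) - x ∈ osIdeal K M := by
    refine Ideal.Quotient.eq.1 ?_
    exact LinearMap.congr_fun hs (q x)
  have h' := hf _ h
  rw [map_sub] at h'
  exact Ideal.Quotient.eq.2 h'

theorem mk_e_eq_zero (hE : M.E = Set.univ) {T : List E}
    (hT : ¬ (T.Nodup ∧ M.Indep {i | i ∈ T})) :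
    Ideal.Quotient.mkₐ K (osIdeal K M) (e K T) = 0 :=
  Ideal.Quotient.eq_zero_iff_mem.2 (e_mem_osIdeal_of_not_indep hE hT)

theorem mk_e_mem_osFlat (T : List E) :
    Ideal.Quotient.mkₐ K (osIdeal K M) (e K T) ∈ osFlat K M (M.closure {i | i ∈ T}) :=
  ⟨e K T, Submodule.subset_span ⟨T, rfl, rfl⟩, rfl⟩

/-- A component is contained in a submodule as soon as the latter contains the monomials of the
independent sequences that span the flat. -/
theorem osFlat_le (hE : M.E = Set.univ) {X : Set E} {W : Submodule K (OSAlgebra K M)}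
    (h : ∀ T : List E, T.Nodup → M.Indep {i | i ∈ T} → M.closure {i | i ∈ T} = X →
      Ideal.Quotient.mkₐ K (osIdeal K M) (e K T) ∈ W) :
    osFlat K M X ≤ W := by
  rw [osFlat, Submodule.map_le_iff_le_comap, extFlat, Submodule.span_le]
  rintro _ ⟨T, hT, rfl⟩
  change Ideal.Quotient.mkₐ K (osIdeal K M) (e K T) ∈ W
  by_cases hi : T.Nodup ∧ M.Indep {i | i ∈ T}
  · exact h T hi.1 hi.2 hT
  · rw [mk_e_eq_zero hE hi]
    exact zero_mem _

/-- The flat spanned by a sequence. -/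
def flatOf (M : Matroid E) (T : List E) : Flats M :=
  ⟨M.closure {i | i ∈ T}, M.isFlat_closure _⟩

/-- Only monomials of independent sequences survive in the quotient, and for these the length equals
the rank of the closure. -/
theorem osGrade_eq_sup (hE : M.E = Set.univ) (k : ℕ) :
    osGrade K M k = (Finset.univ.filter fun X : Flats M => rk M X = k).sup
      fun X => osFlat K M X := by
  apply le_antisymm
  · rw [osGrade, ← span_e_eq_exteriorPower, Submodule.map_le_iff_le_comap, Submodule.span_le]
    rintro _ ⟨T, hT, rfl⟩
    rw [SetLike.mem_coe, Submodule.mem_comap, AlgHom.toLinearMap_apply]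
    by_cases hi : T.Nodup ∧ M.Indep {i | i ∈ T}
    · refine (Finset.le_sup (f := fun X : Flats M => osFlat K M X) (b := flatOf M T) ?_)
        (mk_e_mem_osFlat T)
      simp only [Finset.mem_filter, Finset.mem_univ, true_and]
      rw [← hT]
      exact rk_closure_of_indep hi.1 hi.2
    · rw [mk_e_eq_zero hE hi]
      exact zero_mem _
  · refine Finset.sup_le fun X hX => osFlat_le hE fun T hn hi hT => ?_
    refine ⟨e K T, ?_, rfl⟩
    rw [← span_e_eq_exteriorPower]
    refine Submodule.subset_span ⟨T, ?_, rfl⟩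
    rw [← rk_closure_of_indep hn hi, hT]
    simpa using hX

theorem finiteDimensional_osFlat (hE : M.E = Set.univ) (X : Flats M) :
    FiniteDimensional K (osFlat K M X) := by
  have : FiniteDimensional K (osGrade K M (rk M X)) := by
    unfold osGrade
    infer_instance
  refine Submodule.finiteDimensional_of_le (S₂ := osGrade K M (rk M X)) ?_
  rw [osGrade_eq_sup hE]
  exact Finset.le_sup (f := fun X : Flats M => osFlat K M X) (by simp)

/-- The components of the grading by flats are independent. -/
theorem iSupIndep_osFlat (hE : M.E = Set.univ) :
    iSupIndep fun X : Flats M => osFlat K M X := by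
  choose p hp using fun Y : Flats M =>
    exists_descend (K := K) (M := M) (restrictTo K (Y : Set E)).toLinearMap
      fun x hx => restrictTo_mem_osIdeal Y.2 hx
  refine iSupIndep_of_projections p ?_ ?_
  · intro Y X hXY a ha
    suffices h : osFlat K M X ≤ LinearMap.eqLocus (p Y) LinearMap.id from h ha
    refine osFlat_le hE fun T _ _ hT => ?_
    rw [LinearMap.mem_eqLocus, hp, AlgHom.toLinearMap_apply, restrictTo_e_of_subset]
    · rfl
    · intro i hi
      apply hXY
      rw [← hT]
      exact M.mem_closure_of_mem hi (by simp [hE])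
  · intro Y X hXY a ha
    suffices h : osFlat K M X ≤ LinearMap.ker (p Y) from h ha
    refine osFlat_le hE fun T _ _ hT => ?_
    obtain ⟨i, hi, hiY⟩ : ∃ i ∈ T, i ∉ (Y : Set E) := by
      by_contra! h
      apply hXY
      have := M.closure_subset_closure (show {i | i ∈ T} ⊆ (Y : Set E) from h)
      rw [hT, Y.2.closure] at this
      exact this
    rw [LinearMap.mem_ker, hp, AlgHom.toLinearMap_apply, restrictTo_e_of_notMem K hi hiY,
      map_zero]

open Classical in
/-- The flats below `Y` whose rank has the parity of `n`. -/
def parityFlats (M : Matroid E) (Y : Flats M) (n : ℕ) : Finset (Flats M) :=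
  Finset.univ.filter fun X => X ≤ Y ∧ Even (rk M X + n)

/-- An injective operator shifts the parity of the rank, below a given non-empty flat. -/
theorem exists_parity_shift (hE : M.E = Set.univ) (Y : Flats M) {i : E} (hi : i ∈ (Y : Set E)) :
    ∃ φ : OSAlgebra K M →ₗ[K] OSAlgebra K M, Function.Injective φ ∧ ∀ n,
      ((parityFlats M Y n).sup fun X : Flats M => osFlat K M X) ≤
        ((parityFlats M Y (n + 1)).sup fun X : Flats M => osFlat K M X).comap φ := by
  obtain ⟨φ, hφ⟩ := exists_descend (K := K) (M := M)
    (LinearMap.mulLeft K (ExteriorAlgebra.ι K (Pi.single i (1 : K))) + boundary K E)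
    fun x hx => add_mem (Ideal.mul_mem_left _ _ hx) (boundary_mem_osIdeal hx)
  -- Both `e_i ∧ ·` and `∂` square to zero, and `∂(e_i x) + e_i ∂ x = x`.
  have hinv : Function.Involutive φ := by
    intro a
    obtain ⟨x, rfl⟩ := Ideal.Quotient.mkₐ_surjective K (osIdeal K M) a
    rw [hφ, hφ]
    congr 1
    simp only [LinearMap.add_apply, LinearMap.mulLeft_apply, map_add, boundary_ι_mul,
      boundary_boundary, ← mul_assoc, ExteriorAlgebra.ι_sq_zero]
    simp
  refine ⟨φ, hinv.injective, fun n => Finset.sup_le fun X hX => osFlat_le hE fun T hn hT hX' => ?_⟩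
  obtain ⟨hXY, hpar⟩ : X ≤ Y ∧ Even (rk M X + n) := by simpa [parityFlats] using hX
  have hTY : ∀ j ∈ T, j ∈ (Y : Set E) := by
    intro j hj
    apply hXY
    rw [← hX']
    exact M.mem_closure_of_mem hj (by simp [hE])
  have hlen : T.length = rk M X := by rw [← rk_closure_of_indep hn hT, hX']
  have key : ∀ S : List E, (∀ j ∈ S, j ∈ (Y : Set E)) → Even (S.length + (n + 1)) →
      Ideal.Quotient.mkₐ K (osIdeal K M) (e K S) ∈
        (parityFlats M Y (n + 1)).sup fun X : Flats M => osFlat K M X := by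
    intro S hS hSn
    by_cases hind : S.Nodup ∧ M.Indep {i | i ∈ S}
    · refine (Finset.le_sup (f := fun X : Flats M => osFlat K M X) (b := flatOf M S) ?_)
        (mk_e_mem_osFlat S)
      simp only [parityFlats, Finset.mem_filter, Finset.mem_univ, true_and]
      constructor
      · have := M.closure_subset_closure (show {i | i ∈ S} ⊆ (Y : Set E) from hS)
        rw [Y.2.closure] at this
        exact this
      · change Even (rk M (M.closure {i | i ∈ S}) + (n + 1))
        rwa [rk_closure_of_indep hind.1 hind.2]
    · rw [mk_e_eq_zero hE hind]
      exact zero_mem _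
  rw [Submodule.mem_comap, hφ, LinearMap.add_apply, map_add, LinearMap.mulLeft_apply, ← e_cons]
  refine add_mem (key _ ?_ ?_) ?_
  · intro j hj
    rcases List.mem_cons.1 hj with rfl | hj
    · exact hi
    · exact hTY j hj
  · rw [List.length_cons, hlen]
    have h2 := hpar.add (even_two)
    rwa [show rk M X + 1 + (n + 1) = rk M X + n + 2 by omega]
  · rw [boundary_e, map_sum]
    refine sum_mem fun j _ => ?_
    have hs : (-1 : Ext K E) ^ (j : ℕ) * e K (T.eraseIdx j) =
        (-1 : K) ^ (j : ℕ) • e K (T.eraseIdx j) := by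
      rw [Algebra.smul_def]
      simp
    rw [hs, map_smul]
    refine Submodule.smul_mem _ _ (key _ (fun k hk => hTY k (List.mem_of_mem_eraseIdx hk)) ?_)
    rw [List.length_eraseIdx_of_lt j.2, hlen]
    -- A deleted position exists, so the rank is positive and the subtraction in the length of
    -- `T.eraseIdx j` is not truncated.
    have : 0 < rk M X := hlen ▸ (Nat.zero_le _).trans_lt j.2
    convert hpar using 1
    omega

/-- The alternating sum of the dimensions of the components below a non-empty flat vanishes. -/
theorem sum_neg_one_pow_mul_finrank_osFlat (hE : M.E = Set.univ) (Y : Flats M)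
    (hY : (Y : Set E).Nonempty) :
    ∑ X ∈ Finset.Icc ⊥ Y, (-1 : ℤ) ^ rk M X * Module.finrank K (osFlat K M X) = 0 := by
  classical
  have hfin := finiteDimensional_osFlat (K := K) hE
  obtain ⟨i, hi⟩ := hY
  obtain ⟨φ, hinj, hφ⟩ := exists_parity_shift (K := K) hE Y hi
  have hle : ∀ n, ∑ X ∈ parityFlats M Y n, Module.finrank K (osFlat K M X) ≤
      ∑ X ∈ parityFlats M Y (n + 1), Module.finrank K (osFlat K M X) := by
    intro n
    rw [← finrank_sup_eq_sum (iSupIndep_osFlat hE), ← finrank_sup_eq_sum (iSupIndep_osFlat hE),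
      ← LinearEquiv.finrank_eq (Submodule.equivMapOfInjective φ hinj _).symm]
    exact Submodule.finrank_mono (Submodule.map_le_iff_le_comap.2 (hφ n))
  -- Shifting the parity twice returns to the start, so the inequalities for `n = 0` and `n = 1`
  -- combine into an equality.
  have h2 : parityFlats M Y 2 = parityFlats M Y 0 := by
    ext X
    simp [parityFlats, Nat.even_add]
  have heq : ∑ X ∈ parityFlats M Y 0, Module.finrank K (osFlat K M X) =
      ∑ X ∈ parityFlats M Y 1, Module.finrank K (osFlat K M X) :=
    le_antisymm (hle 0) ((hle 1).trans_eq (by rw [h2]))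
  rw [← Finset.sum_filter_add_sum_filter_not _ (fun X : Flats M => Even (rk M X))]
  have h0 : (Finset.Icc ⊥ Y).filter (fun X : Flats M => Even (rk M X)) = parityFlats M Y 0 := by
    ext X
    simp [parityFlats]
  have h1 : (Finset.Icc ⊥ Y).filter (fun X : Flats M => ¬ Even (rk M X)) = parityFlats M Y 1 := by
    ext X
    simp [parityFlats, Nat.even_add_one]
  rw [h0, h1,
    Finset.sum_congr (g := fun X : Flats M => (Module.finrank K (osFlat K M X) : ℤ)) rfl,
    Finset.sum_congr (s₁ := parityFlats M Y 1)
      (g := fun X : Flats M => -(Module.finrank K (osFlat K M X) : ℤ)) rfl,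
    Finset.sum_neg_distrib]
  · have := congrArg (Nat.cast : ℕ → ℤ) heq
    push_cast at this
    rw [this, add_neg_cancel]
  · intro X hX
    have : Even (rk M X + 1) := by simpa [parityFlats] using (Finset.mem_filter.1 hX).2.2
    rw [Odd.neg_one_pow (by simpa [Nat.even_add_one] using this), neg_one_mul]
  · intro X hX
    have : Even (rk M X) := by simpa [parityFlats] using (Finset.mem_filter.1 hX).2.2
    rw [Even.neg_one_pow this, one_mul]

/-- Restriction to the empty set of coordinates is the augmentation. It kills every `∂ e_C`, whose
terms have positive degree because `|C| ≥ 3`, but it fixes `1`. -/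
theorem one_notMem_osIdeal (hM : IsSimple M) : (1 : Ext K E) ∉ osIdeal K M := by
  intro h
  suffices h' : restrictTo K ∅ (1 : Ext K E) = 0 by simp at h'
  refine osIdeal_induction (p := fun x => restrictTo K ∅ x = 0) ?_ ?_ ?_ h
  · intro C hC a b
    rw [map_mul, map_mul, boundary_e, map_sum, Finset.sum_eq_zero, mul_zero, zero_mul]
    intro j _
    have hC3 : 3 ≤ C.card := by
      have := hM C hC
      rw [Set.encard_coe_eq_coe_finsetCard] at this
      exact_mod_cast this
    obtain ⟨i, hi⟩ : ∃ i, i ∈ (C.sort (· ≤ ·)).eraseIdx j := by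
      refine List.exists_mem_of_length_pos ?_
      rw [List.length_eraseIdx_of_lt j.2, Finset.length_sort]
      omega
    rw [map_mul, restrictTo_e_of_notMem K hi (Set.notMem_empty i), mul_zero]
  · simp
  · intro x y hx hy
    rw [map_add, hx, hy, add_zero]

theorem finrank_osFlat_bot (hE : M.E = Set.univ) (hM : IsSimple M) :
    Module.finrank K (osFlat K M (⊥ : Flats M)) = 1 := by
  have h : osFlat K M (⊥ : Flats M) = Submodule.span K {(1 : OSAlgebra K M)} := by
    apply le_antisymm
    · refine osFlat_le hE fun T _ _ hT => ?_
      rw [coe_bot_eq_empty hM] at hT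
      have hT' : T = [] := by
        refine List.eq_nil_iff_forall_not_mem.2 fun i hi => ?_
        have := M.mem_closure_of_mem (X := {i | i ∈ T}) hi (by simp [hE])
        rw [hT] at this
        exact this
      rw [hT', e_nil, map_one]
      exact Submodule.mem_span_singleton_self _
    · rw [Submodule.span_singleton_le_iff_mem]
      have := mk_e_mem_osFlat (K := K) (M := M) []
      rw [e_nil, map_one] at this
      convert this using 2
      simp only [List.not_mem_nil]
      rfl
  rw [h]
  refine finrank_span_singleton fun h1 => one_notMem_osIdeal (K := K) hM ?_
  exact Ideal.Quotient.eq_zero_iff_mem.1 (by simpa using h1)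

/-- The signed dimensions of the flat components are the values of the Möbius function. -/
theorem mu_eq_neg_one_pow_mul_finrank (hE : M.E = Set.univ) (hM : IsSimple M) (Y : Flats M) :
    mu M Y = (-1) ^ rk M Y * (Module.finrank K (osFlat K M Y) : ℤ) := by
  classical
  induction Y using WellFoundedLT.induction with
  | _ Y ih =>
    by_cases hY : Y = ⊥
    · subst hY
      rw [finrank_osFlat_bot hE hM, rk_bot, mu, IncidenceAlgebra.mu_self]
      simp
    · have hne : (Y : Set E).Nonempty := by
        rw [Set.nonempty_iff_ne_empty]
        intro h
        exact hY (Subtype.ext (h.trans (coe_bot_eq_empty hM).symm))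
      have h := sum_neg_one_pow_mul_finrank_osFlat (K := K) hE Y hne
      -- Isolating the top term `X = Y` turns the vanishing sum into the recursion for `μ` over `[⊥,
      -- Y)`.
      rw [← Finset.Ico_insert_right bot_le, Finset.sum_insert Finset.right_notMem_Ico] at h
      rw [eq_neg_of_add_eq_zero_left h, mu, IncidenceAlgebra.mu_eq_neg_sum_Ico_of_ne (Ne.symm hY)]
      congr 1
      exact Finset.sum_congr rfl fun X hX => ih X (Finset.mem_Ico.1 hX).2

theorem finrank_osFlat_eq (hE : M.E = Set.univ) (hM : IsSimple M) (Y : Flats M) :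
    (Module.finrank K (osFlat K M Y) : ℤ) = (-1) ^ rk M Y * mu M Y := by
  rw [mu_eq_neg_one_pow_mul_finrank (K := K) hE hM, ← mul_assoc, ← mul_pow]
  simp

theorem hilbertSeries_osGrade (hE : M.E = Set.univ) (hM : IsSimple M) :
    hilbertSeries K (osGrade K M) =
      ∑ X : Flats M, PowerSeries.C ((-1 : ℚ) ^ rk M X * (mu M X : ℚ)) *
        PowerSeries.X ^ rk M X := by
  have hfin := finiteDimensional_osFlat (K := K) hE
  ext k
  rw [hilbertSeries, PowerSeries.coeff_mk, osGrade_eq_sup hE,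
    finrank_sup_eq_sum (iSupIndep_osFlat hE), map_sum, Finset.sum_filter, Nat.cast_sum]
  refine Finset.sum_congr rfl fun X _ => ?_
  rw [PowerSeries.coeff_C_mul, PowerSeries.coeff_X_pow]
  have h := congrArg (Int.cast : ℤ → ℚ) (finrank_osFlat_eq (K := K) hE hM X)
  push_cast at h
  by_cases hk : rk M X = k
  · rw [if_pos hk, if_pos hk.symm, h, mul_one]
  · rw [if_neg hk, if_neg (Ne.symm hk), mul_zero, Nat.cast_zero]

end Components

/-- The flat expansion of the Hilbert series in terms of the characteristic polynomial. -/
theorem sum_flats_eq_aeval_charPoly {E : Type*} [Finite E] (M : Matroid E) {r : ℕ}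
    (hr : M.eRank = r) :
    ((∑ X : Flats M, PowerSeries.C ((-1 : ℚ) ^ rk M X * (mu M X : ℚ)) *
        PowerSeries.X ^ rk M X : PowerSeries ℚ) : LaurentSeries ℚ) =
      (-((PowerSeries.X : PowerSeries ℚ) : LaurentSeries ℚ)) ^ r *
        Polynomial.aeval (-1 / ((PowerSeries.X : PowerSeries ℚ) : LaurentSeries ℚ))
          (charPoly M) := by
  set t : LaurentSeries ℚ := ((PowerSeries.X : PowerSeries ℚ) : LaurentSeries ℚ) with ht
  have ht0 : t ≠ 0 := by
    rw [ht, PowerSeries.coe_X]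
    exact HahnSeries.single_ne_zero one_ne_zero
  have hrE : rk M M.E = r := by
    rw [rk, M.eRk_ground, hr]
    rfl
  rw [charPoly, map_sum, map_sum, Finset.mul_sum]
  refine Finset.sum_congr rfl fun X _ => ?_
  have hX : rk M X ≤ r := by
    rw [← hrE]
    exact ENat.toNat_le_toNat (M.eRk_mono X.2.subset_ground) (by simp [hr])
  have hC : HahnSeries.ofPowerSeries ℤ ℚ (PowerSeries.C ((-1 : ℚ) ^ rk M X * (mu M X : ℚ))) =
      (-1) ^ rk M X * (mu M X : LaurentSeries ℚ) := by
    simp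
  rw [map_mul, map_pow, ← ht, hC, map_mul, map_pow, Polynomial.aeval_C, Polynomial.aeval_X,
    eq_intCast, hrE]
  obtain ⟨d, rfl⟩ := Nat.exists_eq_add_of_le hX
  -- With `d = r - r(X)`, the power `(-1/t)^d` from `χ` cancels `d` of the `r` factors `-t`, leaving
  -- `(-t)^r(X)`.
  have hd : (-t) ^ d * (-1 / t) ^ d = 1 := by
    rw [← mul_pow, show -t * (-1 / t) = 1 by field_simp, one_pow]
  rw [Nat.add_sub_cancel_left, pow_add, neg_pow t (rk M X)]
  linear_combination (-(-1) ^ rk M X * (mu M X : LaurentSeries ℚ) * t ^ rk M X) * hd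

end OrlikSolomon

end

theorem corollary1p4 {K : Type*} [Field K] (hK : ringChar K ≠ 2)
    {E : Type*} [Fintype E] [LinearOrder E]
    (M : Matroid E) (hE : M.E = Set.univ) (hM : OrlikSolomon.IsSimple M)
    (r : ℕ) (hr : M.eRank = r) :
    (∀ Y : OrlikSolomon.Flats M,
      (Module.finrank K (OrlikSolomon.osFlat K M Y) : ℤ) =
        (-1) ^ OrlikSolomon.rk M Y * OrlikSolomon.mu M Y) ∧
    OrlikSolomon.hilbertSeries K (OrlikSolomon.osGrade K M) =
      ∑ X : OrlikSolomon.Flats M,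
        PowerSeries.C ((-1 : ℚ) ^ OrlikSolomon.rk M X * (OrlikSolomon.mu M X : ℚ)) *
          PowerSeries.X ^ OrlikSolomon.rk M X ∧
    (OrlikSolomon.hilbertSeries K (OrlikSolomon.osGrade K M) : LaurentSeries ℚ) =
      (-((PowerSeries.X : PowerSeries ℚ) : LaurentSeries ℚ)) ^ r *
        Polynomial.aeval (-1 / ((PowerSeries.X : PowerSeries ℚ) : LaurentSeries ℚ))
          (OrlikSolomon.charPoly M) := by
  refine ⟨OrlikSolomon.finrank_osFlat_eq hE hM, OrlikSolomon.hilbertSeries_osGrade hE hM, ?_⟩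
  rw [OrlikSolomon.hilbertSeries_osGrade hE hM]
  exact OrlikSolomon.sum_flats_eq_aeval_charPoly M hr
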